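/- Let $q$ be a complex number with $|q|<1$. For $n\in\mathbb{Z}_{\ge 0}\cup\{\infty\}$ put $(A;q)_n:=\prod_{j=0}^{n-1}(1-Aq^j)$, and for nonnegative integers $N,M$ put $$\begin{bmatrix}N\\M\end{bmatrix}_q:=\frac{(q;q)_N}{(q;q)_M(q;q)_{N-M}}\ \text{ if } M\le N,\qquad \begin{bmatrix}N\\M\end{bmatrix}_q:=0\ \text{ otherwise.}$$ Then for every positive integer $k$, $$\frac{(q^2;q^2)_\infty\,(q^{k+1};q^{k+1})_\infty^2}{(q;q)_\infty^3\,(q^{2k+2};q^{2k+2})_\infty} =\sum_{\substack{m_1,\ldots,m_k\ge 0\\ n_1,\ldots,n_k\ge 0}} \frac{(-1)^{\sum_{i=1}^k m_i}\,q^{-n_1^2+n_1+\sum_{i=1}^k(m_i^2+m_in_i+n_i^2)}\,(-1;q)_{n_1}^2}{(q;q)_{m_k}(q;q)_{m_1}(q;q)_{n_1}} \prod_{i=1}^{k-1}\begin{bmatrix}m_{i+1}\\m_i\end{bmatrix}_q\ \prod_{i=1}^{k-1}\begin{bmatrix}n_i\\n_{i+1}\end{bmatrix}_q,$$ where the $2k$-fold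 series on the right converges absolutely. -/

import Mathlib

/-- The finite `q`-Pochhammer symbol `(a; q)_n = ∏_{j=0}^{n-1} (1 - a q^j)`. -/
noncomputable def qPoch (a q : ℂ) (n : ℕ) : ℂ :=
  ∏ j ∈ Finset.range n, (1 - a * q ^ j)

/-- The infinite `q`-Pochhammer symbol `(a; q)_∞ = ∏_{j ≥ 0} (1 - a q^j)`. -/
noncomputable def qPochInf (a q : ℂ) : ℂ :=
  ∏' j : ℕ, (1 - a * q ^ j)

/-- For `|q| < 1` the infinite product defining `(a; q)_∞` converges. -/
theorem multipliable_qPochInf (a : ℂ) {q : ℂ} (hq : ‖q‖ < 1) :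
    Multipliable fun j : ℕ => 1 - a * q ^ j := by
  have h : Summable fun j : ℕ => ‖-(a * q ^ j)‖ := by
    simpa [norm_mul, norm_pow] using
      (summable_geometric_of_lt_one (norm_nonneg q) hq).mul_left ‖a‖
  simpa [sub_eq_add_neg] using multipliable_one_add_of_summable h

/-- The `q`-binomial coefficient: `(q;q)_N / ((q;q)_M (q;q)_{N-M})` if `M ≤ N`, and `0`
otherwise. -/
noncomputable def qBinom (q : ℂ) (N M : ℕ) : ℂ :=
  if M ≤ N then qPoch q q N / (qPoch q q M * qPoch q q (N - M)) else 0

/-! Write (a)_n for (a;q)_n and c = (-q)_∞/(q)_∞. The q-binomials telescope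
(`summand_eq_chainTerm`), so the series can be summed one pair (m_i, n_i) at a time, each summation
being a `chainStep`. Up to the quadratic weights, the results stay in the span of the functions
`chainBasis q N`: a step sends function N to the sum over j of q^{j²}/(q)_{N-j} times function j
(`chainStep_chainBasis`), and the first pair produces the coefficients c · `baileySeed`
(`chainStep_chainHead`). The 2k-fold sum thus reduces to iterating the single-index map
`baileyStep`; letting m → ∞ at n = 0 identifies it with (q)_∞⁻¹ times term 0 of the k-th iterate
(`chainEnd_iterate`).

This map is governed by the Bailey lemma with a = 1: `baileyConj` turns it into multiplication by
q^{r²} (`baileyConj_baileyStep`), and the unit Bailey pair recovers term 0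
(`tsum_unitBailey_mul_baileyConj`). The transform of the seed is explicit, so term 0 equals c
Σ_{r∈ℤ} (-1)^r q^{(k+1)r²}. The same formula at k = 0 yields Gauss's product for the theta series,
which in base q^{k+1} finishes the evaluation. -/

theorem choose_two_add (a b : ℕ) :
    (a + b).choose 2 = a.choose 2 + b.choose 2 + a * b := by
  induction b with
  | zero => simp
  | succ b ih =>
    rw [← add_assoc, Nat.choose_succ_succ' (a + b) 1, Nat.choose_succ_succ' b 1, ih]
    simp only [Nat.choose_one_right]
    ring

/-! ### Finite q-Pochhammer symbols and terminating sums. -/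

theorem qPoch_zero (a q : ℂ) : qPoch a q 0 = 1 := by simp [qPoch]

theorem qPoch_succ (a q : ℂ) (n : ℕ) : qPoch a q (n + 1) = qPoch a q n * (1 - a * q ^ n) := by
  simp [qPoch, Finset.prod_range_succ]

theorem qPoch_add (a q : ℂ) (m n : ℕ) :
    qPoch a q (m + n) = qPoch a q m * qPoch (a * q ^ m) q n := by
  simp only [qPoch, Finset.prod_range_add]
  congr 1
  exact Finset.prod_congr rfl fun j _ => by ring

theorem norm_pow_succ_lt_one {q : ℂ} (hq : ‖q‖ < 1) (n : ℕ) : ‖q ^ (n + 1)‖ < 1 := by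
  rw [norm_pow]
  exact pow_lt_one₀ (norm_nonneg q) hq n.succ_ne_zero

theorem one_sub_ne_zero_of_norm_lt {x : ℂ} (h : ‖x‖ < 1) : 1 - x ≠ 0 := by
  intro h0
  rw [← sub_eq_zero.mp h0] at h
  simp at h

theorem qPoch_ne_zero {a q : ℂ} (ha : ‖a‖ < 1) (hq : ‖q‖ < 1) (n : ℕ) : qPoch a q n ≠ 0 := by
  refine Finset.prod_ne_zero_iff.mpr fun j _ => one_sub_ne_zero_of_norm_lt ?_
  rw [norm_mul, norm_pow]
  exact (mul_le_of_le_one_right (norm_nonneg a) (pow_le_one₀ (norm_nonneg q) hq.le)).trans_lt ha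

/-- The reciprocal of `(q; q)_n`. -/
noncomputable def qFactInv (q : ℂ) (n : ℕ) : ℂ := (qPoch q q n)⁻¹

theorem qFactInv_zero (q : ℂ) : qFactInv q 0 = 1 := by simp [qFactInv, qPoch_zero]

theorem one_sub_mul_qFactInv_succ {q : ℂ} (hq : ‖q‖ < 1) (n : ℕ) :
    (1 - q ^ (n + 1)) * qFactInv q (n + 1) = qFactInv q n := by
  have h := one_sub_ne_zero_of_norm_lt (norm_pow_succ_lt_one hq n)
  have h1 := qPoch_ne_zero hq hq n
  have h2 : 1 - q * q ^ n ≠ 0 := by rwa [← pow_succ']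
  rw [qFactInv, qFactInv, qPoch_succ, pow_succ']
  field_simp

/-- The finite `q`-binomial theorem. -/
theorem sum_antidiagonal_qBinomial {q : ℂ} (hq : ‖q‖ < 1) (x : ℂ) (L : ℕ) :
    ∑ p ∈ Finset.HasAntidiagonal.antidiagonal L,
        x ^ p.1 * q ^ p.1.choose 2 * qFactInv q p.1 * qFactInv q p.2
      = qPoch (-x) q L * qFactInv q L := by
  induction L with
  | zero => simp [qPoch_zero, qFactInv_zero]
  | succ L ih =>
    have h := one_sub_ne_zero_of_norm_lt (norm_pow_succ_lt_one hq L)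
    refine mul_left_cancel₀ h ?_
    -- q-Pascal rule: 1 - q^{s+t} = (1 - q^t) + q^t (1 - q^s).
    have key : (1 - q ^ (L + 1)) * ∑ p ∈ Finset.HasAntidiagonal.antidiagonal (L + 1),
          x ^ p.1 * q ^ p.1.choose 2 * qFactInv q p.1 * qFactInv q p.2
        = ∑ p ∈ Finset.HasAntidiagonal.antidiagonal (L + 1),
            x ^ p.1 * q ^ p.1.choose 2 * qFactInv q p.1 * ((1 - q ^ p.2) * qFactInv q p.2)
          + ∑ p ∈ Finset.HasAntidiagonal.antidiagonal (L + 1),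
            x ^ p.1 * q ^ p.1.choose 2 * ((1 - q ^ p.1) * qFactInv q p.1)
              * (q ^ p.2 * qFactInv q p.2) := by
      rw [Finset.mul_sum, ← Finset.sum_add_distrib]
      refine Finset.sum_congr rfl fun p hp => ?_
      rw [← Finset.HasAntidiagonal.mem_antidiagonal.mp hp, pow_add]
      ring
    rw [key, Finset.Nat.sum_antidiagonal_succ', Finset.Nat.sum_antidiagonal_succ]
    simp only [pow_zero, sub_self, zero_mul, mul_zero, zero_add,
      one_sub_mul_qFactInv_succ hq, ih]
    have h2 : ∑ p ∈ Finset.HasAntidiagonal.antidiagonal L,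
          x ^ (p.1 + 1) * q ^ (p.1 + 1).choose 2 * qFactInv q p.1 * (q ^ p.2 * qFactInv q p.2)
        = x * q ^ L * ∑ p ∈ Finset.HasAntidiagonal.antidiagonal L,
          x ^ p.1 * q ^ p.1.choose 2 * qFactInv q p.1 * qFactInv q p.2 := by
      rw [Finset.mul_sum]
      refine Finset.sum_congr rfl fun p hp => ?_
      rw [← Finset.HasAntidiagonal.mem_antidiagonal.mp hp, choose_two_add]
      simp only [pow_add, pow_one, mul_one, Nat.choose_eq_zero_of_lt one_lt_two]
      ring
    rw [h2, ih, qPoch_succ, ← one_sub_mul_qFactInv_succ hq L]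
    ring

/-- Interchange of the order of summation over compositions into three parts. -/
theorem sum_antidiagonal_assoc (f : ℕ → ℕ → ℕ → ℂ) (L : ℕ) :
    ∑ p ∈ Finset.HasAntidiagonal.antidiagonal L, ∑ r ∈ Finset.HasAntidiagonal.antidiagonal p.1, f r.1 r.2 p.2
      = ∑ p ∈ Finset.HasAntidiagonal.antidiagonal L, ∑ r ∈ Finset.HasAntidiagonal.antidiagonal p.2, f p.1 r.1 r.2 := by
  rw [Finset.sum_sigma', Finset.sum_sigma']
  exact Finset.sum_nbij' (fun x => ⟨(x.2.1, x.2.2 + x.1.2), (x.2.2, x.1.2)⟩)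
    (fun x => ⟨(x.1.1 + x.2.1, x.2.2), (x.1.1, x.2.1)⟩)
    (by rintro ⟨⟨a, b⟩, c, d⟩; simp; omega)
    (by rintro ⟨⟨a, b⟩, c, d⟩; simp; omega)
    (by rintro ⟨⟨a, b⟩, c, d⟩; simp)
    (by rintro ⟨⟨a, b⟩, c, d⟩; simp)
    (by rintro ⟨⟨a, b⟩, c, d⟩; simp)

/-- A transformation of terminating `₂φ₁`-type sums. -/
theorem sum_antidiagonal_transform {q : ℂ} (hq : ‖q‖ < 1) (a x : ℂ) (L : ℕ) :
    ∑ p ∈ Finset.HasAntidiagonal.antidiagonal L,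
        qPoch a q p.1 * x ^ p.1 * q ^ p.1.choose 2 * qFactInv q p.1 * qFactInv q p.2
      = ∑ p ∈ Finset.HasAntidiagonal.antidiagonal L,
        (-(a * x)) ^ p.1 * q ^ (2 * p.1.choose 2) * qPoch (-(x * q ^ p.1)) q p.2
          * qFactInv q p.1 * qFactInv q p.2 := by
  -- Expand (a)_p by the finite q-binomial theorem, swap the sums, and resum the inner one by the
  -- same theorem.
  trans ∑ p ∈ Finset.HasAntidiagonal.antidiagonal L, ∑ r ∈ Finset.HasAntidiagonal.antidiagonal p.1,
      (-a) ^ r.1 * q ^ r.1.choose 2 * qFactInv q r.1 * qFactInv q r.2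
        * (x ^ (r.1 + r.2) * q ^ (r.1 + r.2).choose 2 * qFactInv q p.2)
  · refine Finset.sum_congr rfl fun p _ => ?_
    have h := sum_antidiagonal_qBinomial hq (-a) p.1
    rw [neg_neg] at h
    trans (qPoch a q p.1 * qFactInv q p.1) * (x ^ p.1 * q ^ p.1.choose 2 * qFactInv q p.2)
    · ring
    · rw [← h, Finset.sum_mul]
      refine Finset.sum_congr rfl fun r hr => ?_
      rw [Finset.HasAntidiagonal.mem_antidiagonal.mp hr]
  · rw [sum_antidiagonal_assoc (fun s v u => (-a) ^ s * q ^ s.choose 2 * qFactInv q s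
        * qFactInv q v * (x ^ (s + v) * q ^ (s + v).choose 2 * qFactInv q u))]
    refine Finset.sum_congr rfl fun p _ => ?_
    have h := sum_antidiagonal_qBinomial hq (x * q ^ p.1) p.2
    trans (-(a * x)) ^ p.1 * q ^ (2 * p.1.choose 2) * qFactInv q p.1
      * (qPoch (-(x * q ^ p.1)) q p.2 * qFactInv q p.2)
    · rw [← h, Finset.mul_sum]
      refine Finset.sum_congr rfl fun r _ => ?_
      rw [choose_two_add]
      simp only [pow_add, mul_pow, two_mul, neg_mul_eq_neg_mul, ← pow_mul]
      ring
    · ring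

theorem qPoch_one_succ (q : ℂ) (n : ℕ) : qPoch 1 q (n + 1) = 0 := by
  rw [add_comm, qPoch_add]
  simp [qPoch]

/-- The limiting `q`-Chu-Vandermonde sum, cleared of denominators. -/
theorem sum_antidiagonal_vandermonde {q : ℂ} (hq : ‖q‖ < 1) (c : ℂ) (L : ℕ) :
    ∑ p ∈ Finset.HasAntidiagonal.antidiagonal L,
        c ^ p.1 * q ^ (2 * p.1.choose 2) * qPoch (c * q ^ p.1) q p.2
          * qFactInv q p.1 * qFactInv q p.2 = qFactInv q L := by
  -- At a = 1 the left side collapses to its first term, since (1)_n = 0 for n > 0.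
  have h := sum_antidiagonal_transform hq 1 (-c) L
  simp only [one_mul, neg_neg, neg_mul] at h
  rw [← h]
  cases L with
  | zero => simp [qPoch_zero, qFactInv_zero]
  | succ L => simp [Finset.Nat.sum_antidiagonal_succ, qPoch_one_succ, qPoch_zero, qFactInv_zero]

/-- The reciprocal of `(q; q)_{a - b}`, extended by zero to `b > a`. -/
noncomputable def qFactSubInv (q : ℂ) (a b : ℕ) : ℂ := if b ≤ a then qFactInv q (a - b) else 0

theorem qFactSubInv_of_lt {q : ℂ} {a b : ℕ} (h : a < b) : qFactSubInv q a b = 0 :=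
  if_neg h.not_ge

theorem qFactSubInv_add (q : ℂ) (a b : ℕ) : qFactSubInv q (a + b) a = qFactInv q b := by
  simp [qFactSubInv]

theorem qFactSubInv_zero (q : ℂ) (a : ℕ) : qFactSubInv q a 0 = qFactInv q a := by
  simp [qFactSubInv]

theorem sum_range_qFactSubInv (q : ℂ) (g : ℕ → ℂ) (n L : ℕ) :
    ∑ j ∈ Finset.range (n + L + 1), qFactSubInv q (n + L) j * qFactSubInv q j n * g j
      = ∑ p ∈ Finset.HasAntidiagonal.antidiagonal L, qFactInv q p.1 * qFactInv q p.2 * g (n + p.1) := by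
  rw [add_assoc, Finset.sum_range_add, Finset.sum_eq_zero, zero_add,
    Finset.Nat.sum_antidiagonal_eq_sum_range_succ_mk]
  · refine Finset.sum_congr rfl fun j hj => ?_
    have hj' : j ≤ L := Finset.mem_range_succ_iff.mp hj
    rw [qFactSubInv_add, qFactSubInv, if_pos (by omega), Nat.add_sub_add_left]
    ring
  · intro j hj
    rw [qFactSubInv_of_lt (Finset.mem_range.mp hj)]
    ring

theorem sum_range_qFactSubInv_of_lt (q : ℂ) (g : ℕ → ℂ) {n N : ℕ} (h : N < n) :
    ∑ j ∈ Finset.range (N + 1), qFactSubInv q N j * qFactSubInv q j n * g j = 0 := by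
  refine Finset.sum_eq_zero fun j hj => ?_
  rw [qFactSubInv_of_lt (a := j) (b := n) (by have := Finset.mem_range.mp hj; omega)]
  ring

/-! ### Infinite products, uniform bounds and summability. -/

open Filter Topology in
theorem tendsto_qPoch (a : ℂ) {q : ℂ} (hq : ‖q‖ < 1) :
    Tendsto (qPoch a q) atTop (𝓝 (qPochInf a q)) :=
  (multipliable_qPochInf a hq).tendsto_prod_tprod_nat

theorem qPochInf_eq_mul (a : ℂ) {q : ℂ} (hq : ‖q‖ < 1) (n : ℕ) :
    qPochInf a q = qPoch a q n * qPochInf (a * q ^ n) q := by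
  have h := Multipliable.prod_mul_tprod_nat_mul' (f := fun j => 1 - a * q ^ j) (k := n) (by
    simpa only [pow_add, mul_assoc, mul_left_comm, mul_comm] using
      multipliable_qPochInf (a * q ^ n) hq)
  rw [qPochInf, ← h, qPoch, qPochInf]
  congr 1
  exact tprod_congr fun j => by ring

theorem qPochInf_ne_zero {a q : ℂ} (ha : ‖a‖ < 1) (hq : ‖q‖ < 1) : qPochInf a q ≠ 0 := by
  have h : Summable fun j : ℕ => ‖-(a * q ^ j)‖ := by
    simpa [norm_mul, norm_pow] using
      (summable_geometric_of_lt_one (norm_nonneg q) hq).mul_left ‖a‖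
  have h' := tprod_one_add_ne_zero_of_summable (f := fun j : ℕ => -(a * q ^ j)) (fun j => by
    rw [← sub_eq_add_neg]
    refine one_sub_ne_zero_of_norm_lt ?_
    rw [norm_mul, norm_pow]
    exact (mul_le_of_le_one_right (norm_nonneg a)
      (pow_le_one₀ (norm_nonneg q) hq.le)).trans_lt ha) h
  simpa only [qPochInf, sub_eq_add_neg] using h'

theorem exists_norm_le_of_tendsto {u : ℕ → ℂ} {l : ℂ} (h : Filter.Tendsto u Filter.atTop (nhds l)) :
    ∃ C : ℝ, 0 ≤ C ∧ ∀ n, ‖u n‖ ≤ C := by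
  obtain ⟨C, hC⟩ := h.norm.bddAbove_range
  exact ⟨C, (norm_nonneg _).trans (hC ⟨0, rfl⟩), fun n => hC ⟨n, rfl⟩⟩

theorem exists_norm_qPoch_le (a : ℂ) {q : ℂ} (hq : ‖q‖ < 1) :
    ∃ C : ℝ, 0 ≤ C ∧ ∀ n, ‖qPoch a q n‖ ≤ C :=
  exists_norm_le_of_tendsto (tendsto_qPoch a hq)

theorem exists_norm_inv_qPoch_le {a q : ℂ} (ha : ‖a‖ < 1) (hq : ‖q‖ < 1) :
    ∃ C : ℝ, 0 ≤ C ∧ ∀ n, ‖(qPoch a q n)⁻¹‖ ≤ C :=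
  exists_norm_le_of_tendsto ((tendsto_qPoch a hq).inv₀ (qPochInf_ne_zero ha hq))

theorem exists_norm_qFactSubInv_le {q : ℂ} (hq : ‖q‖ < 1) :
    ∃ C : ℝ, 0 ≤ C ∧ (∀ n, ‖qFactInv q n‖ ≤ C) ∧ ∀ a b, ‖qFactSubInv q a b‖ ≤ C := by
  obtain ⟨C, hC, h⟩ := exists_norm_inv_qPoch_le hq hq
  refine ⟨C, hC, h, fun a b => ?_⟩
  unfold qFactSubInv
  split_ifs
  · exact h _
  · simpa using hC

theorem summable_of_norm_le_geometric {u : ℕ → ℂ} {C r : ℝ} (hr0 : 0 ≤ r) (hr : r < 1)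
    (h : ∀ n, ‖u n‖ ≤ C * r ^ n) : Summable u :=
  .of_norm_bounded ((summable_geometric_of_lt_one hr0 hr).mul_left C) h

theorem summable_geometric_mul {r : ℝ} (hr0 : 0 ≤ r) (hr : r < 1) (C : ℝ) :
    Summable fun p : ℕ × ℕ => C * (r ^ p.1 * r ^ p.2) :=
  ((summable_geometric_of_lt_one hr0 hr).mul_of_nonneg (summable_geometric_of_lt_one hr0 hr)
    (fun _ => pow_nonneg hr0 _) (fun _ => pow_nonneg hr0 _)).mul_left C

theorem summable_of_norm_le_geometric_mul {u : ℕ × ℕ → ℂ} {C r : ℝ} (hr0 : 0 ≤ r) (hr : r < 1)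
    (h : ∀ m n, ‖u (m, n)‖ ≤ C * (r ^ m * r ^ n)) : Summable u :=
  .of_norm_bounded (summable_geometric_mul hr0 hr C) fun p => h p.1 p.2

theorem summable_of_norm_le_geometric_mul₃ {u : ℕ × (ℕ × ℕ) → ℂ} {C r : ℝ} (hr0 : 0 ≤ r)
    (hr : r < 1) (h : ∀ k m n, ‖u (k, (m, n))‖ ≤ C * (r ^ k * (r ^ m * r ^ n))) : Summable u := by
  have h1 := summable_geometric_mul hr0 hr 1
  simp only [one_mul] at h1
  exact .of_norm_bounded (((summable_geometric_of_lt_one hr0 hr).mul_of_nonneg h1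
    (fun _ => pow_nonneg hr0 _)
    (fun _ => mul_nonneg (pow_nonneg hr0 _) (pow_nonneg hr0 _))).mul_left C)
    fun p => h p.1 p.2.1 p.2.2

theorem tsum_sum_antidiagonal {g : ℕ × ℕ → ℂ} (hg : Summable g) :
    ∑' n, ∑ p ∈ Finset.HasAntidiagonal.antidiagonal n, g p = ∑' i, ∑' j, g (i, j) := by
  rw [← hg.tsum_prod, ← Finset.HasAntidiagonal.sigmaAntidiagonalEquivProd.tsum_eq g]
  refine Eq.trans ?_
    (Finset.HasAntidiagonal.sigmaAntidiagonalEquivProd.summable_iff.mpr hg).tsum_sigma.symm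
  refine tsum_congr fun n => ?_
  rw [tsum_fintype, Finset.univ_eq_attach, ← Finset.sum_attach]
  rfl

/-! ### The q-binomial theorem and Heine's transformation. -/

theorem summable_qBinomial (a : ℂ) {q z : ℂ} (hq : ‖q‖ < 1) (hz : ‖z‖ < 1) :
    Summable fun n => qPoch a q n * z ^ n * qFactInv q n := by
  obtain ⟨A, hA0, hA⟩ := exists_norm_qPoch_le a hq
  obtain ⟨B, hB0, hB, -⟩ := exists_norm_qFactSubInv_le hq
  refine summable_of_norm_le_geometric (C := A * B) (norm_nonneg z) hz fun n => ?_
  rw [norm_mul, norm_mul, norm_pow, mul_right_comm]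
  gcongr
  · exact hA n
  · exact hB n

theorem norm_mul_pow_lt_one {q z : ℂ} (hq : ‖q‖ < 1) (hz : ‖z‖ < 1) (n : ℕ) :
    ‖z * q ^ n‖ < 1 := by
  rw [norm_mul, norm_pow]
  exact (mul_le_of_le_one_right (norm_nonneg z) (pow_le_one₀ (norm_nonneg q) hq.le)).trans_lt hz

/-- Comparing coefficients of z^{n+1} reduces this to the recursions of (a)_n and 1/(q)_n. Iterating
z ↦ zq then produces the two infinite products. -/
theorem qBinomial_functional_eq (a : ℂ) {q z : ℂ} (hq : ‖q‖ < 1) (hz : ‖z‖ < 1) :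
    (1 - z) * ∑' n, qPoch a q n * z ^ n * qFactInv q n
      = (1 - a * z) * ∑' n, qPoch a q n * (z * q) ^ n * qFactInv q n := by
  have hzq : ‖z * q‖ < 1 := by simpa using norm_mul_pow_lt_one hq hz 1
  have h1 := summable_qBinomial a hq hz
  have h2 := summable_qBinomial a hq hzq
  have key : ∑' n, qPoch a q n * z ^ n * qFactInv q n
        - ∑' n, qPoch a q n * (z * q) ^ n * qFactInv q n
      = z * ∑' n, qPoch a q n * z ^ n * qFactInv q n
        - a * z * ∑' n, qPoch a q n * (z * q) ^ n * qFactInv q n := by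
    rw [← h1.tsum_sub h2, (h1.sub h2).tsum_eq_zero_add, ← tsum_mul_left, ← tsum_mul_left,
      ← (h1.mul_left z).tsum_sub (h2.mul_left (a * z))]
    simp only [pow_zero, sub_self, zero_add]
    refine tsum_congr fun n => ?_
    rw [← one_sub_mul_qFactInv_succ hq n, qPoch_succ]
    ring
  linear_combination key

open Filter Topology in
/-- The `q`-binomial theorem. -/
theorem tsum_qBinomial (a : ℂ) {q z : ℂ} (hq : ‖q‖ < 1) (hz : ‖z‖ < 1) :
    ∑' n, qPoch a q n * z ^ n * qFactInv q n = qPochInf (a * z) q / qPochInf z q := by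
  set f : ℂ → ℂ := fun w => ∑' n, qPoch a q n * w ^ n * qFactInv q n with hf
  have hiter : ∀ n, qPoch z q n * f z = qPoch (a * z) q n * f (z * q ^ n) := by
    intro n
    induction n with
    | zero => simp [qPoch_zero]
    | succ n ih =>
      have h := qBinomial_functional_eq a hq (norm_mul_pow_lt_one hq hz n)
      rw [mul_assoc z, ← pow_succ] at h
      rw [qPoch_succ, qPoch_succ, mul_right_comm, ih]
      linear_combination qPoch (a * z) q n * h
  obtain ⟨A, hA0, hA⟩ := exists_norm_qPoch_le a hq
  obtain ⟨B, hB0, hB, -⟩ := exists_norm_qFactSubInv_le hq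
  have hlim : Tendsto (fun n : ℕ => f (z * q ^ n)) atTop
      (𝓝 (∑' n, qPoch a q n * 0 ^ n * qFactInv q n)) := by
    refine tendsto_tsum_of_dominated_convergence (bound := fun k => A * B * ‖z‖ ^ k)
      ((summable_geometric_of_lt_one (norm_nonneg z) hz).mul_left _) (fun k => ?_)
      (Eventually.of_forall fun n k => ?_)
    · have h0 : Tendsto (fun n : ℕ => z * q ^ n) atTop (𝓝 0) := by
        simpa using (tendsto_pow_atTop_nhds_zero_of_norm_lt_one hq).const_mul z
      exact ((h0.pow k).const_mul _).mul_const _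
    · rw [norm_mul, norm_mul, norm_pow, mul_right_comm]
      gcongr
      · exact hA k
      · exact hB k
      · rw [norm_mul, norm_pow]
        exact mul_le_of_le_one_right (norm_nonneg z) (pow_le_one₀ (norm_nonneg q) hq.le)
  have h0 : ∑' n, qPoch a q n * 0 ^ n * qFactInv q n = 1 := by
    rw [tsum_eq_single 0 fun n hn => by simp [hn]]
    simp [qPoch_zero, qFactInv_zero]
  rw [h0] at hlim
  have h1 := (tendsto_qPoch z hq).mul_const (f z)
  have h2 := (tendsto_qPoch (a * z) hq).mul hlim
  rw [eq_div_iff (qPochInf_ne_zero hz hq), mul_comm]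
  have := tendsto_nhds_unique (h1.congr hiter) h2
  rwa [mul_one] at this

/-- Heine's transformation, in the limiting case of a vanishing lower parameter. -/
theorem tsum_heine {a b q z : ℂ} (ha : ‖a‖ ≤ 1) (hq : ‖q‖ < 1) (hz : ‖z‖ < 1) :
    ∑' n, qPoch a q n * qPoch b q n * z ^ n * qFactInv q n
      = ∑' j, qPoch b q j * (-(a * z)) ^ j * q ^ j.choose 2 * qFactInv q j
          * (qPochInf (b * z * q ^ j) q / qPochInf z q) := by
  obtain ⟨A, hA0, hA⟩ := exists_norm_qPoch_le b hq
  obtain ⟨B, hB0, hB, -⟩ := exists_norm_qFactSubInv_le hq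
  -- (a)_n is expanded by the finite q-binomial theorem and the inner series is summed by the
  -- infinite one. The bound ‖a‖ ≤ 1 controls (-a)^m; the boundary values a = ±1 do occur later.
  set g : ℕ × ℕ → ℂ := fun p => (-a) ^ p.1 * q ^ p.1.choose 2 * qFactInv q p.1 * qFactInv q p.2
    * (qPoch b q (p.1 + p.2) * z ^ (p.1 + p.2)) with hg
  have hsum : Summable g := by
    refine summable_of_norm_le_geometric_mul (C := B * B * A) (norm_nonneg z) hz fun m n => ?_
    simp only [hg, norm_mul, norm_pow, norm_neg, pow_add]
    calc _ ≤ 1 ^ m * 1 ^ m.choose 2 * B * B * (A * (‖z‖ ^ m * ‖z‖ ^ n)) := by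
          gcongr
          · exact hB m
          · exact hB n
          · exact hA _
      _ = _ := by ring
  trans ∑' n, ∑ p ∈ Finset.HasAntidiagonal.antidiagonal n, g p
  · refine tsum_congr fun n => ?_
    have h := sum_antidiagonal_qBinomial hq (-a) n
    rw [neg_neg] at h
    trans (qPoch a q n * qFactInv q n) * (qPoch b q n * z ^ n)
    · ring
    · rw [← h, Finset.sum_mul]
      refine Finset.sum_congr rfl fun p hp => ?_
      simp only [hg, Finset.HasAntidiagonal.mem_antidiagonal.mp hp]
  · rw [tsum_sum_antidiagonal hsum]
    refine tsum_congr fun j => ?_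
    have h := tsum_qBinomial (b * q ^ j) hq hz
    rw [mul_right_comm] at h
    rw [← h, ← tsum_mul_left]
    refine tsum_congr fun n => ?_
    simp only [hg, qPoch_add, pow_add, mul_pow, neg_mul_eq_neg_mul]
    ring

/-! ### The finite summations behind one step of the chain. -/

theorem sq_eq_add_two_mul_choose (n : ℕ) : n ^ 2 = n + 2 * n.choose 2 := by
  induction n with
  | zero => simp
  | succ n ih =>
    rw [choose_two_add, Nat.choose_eq_zero_of_lt one_lt_two]
    linarith [ih]

theorem choose_two_add_add_one (a b : ℕ) :
    (a + b + 1).choose 2 = a.choose 2 + b.choose 2 + a * b + a + b := by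
  rw [choose_two_add, choose_two_add, Nat.choose_eq_zero_of_lt one_lt_two]
  ring

theorem choose_two_succ (a : ℕ) : (a + 1).choose 2 = a.choose 2 + a := by
  rw [choose_two_add, Nat.choose_eq_zero_of_lt one_lt_two]
  ring

theorem norm_neg_lt_one {q : ℂ} (hq : ‖q‖ < 1) : ‖-q‖ < 1 := by rwa [norm_neg]

theorem qPoch_tail_mul_inv {a q : ℂ} (ha : ‖a‖ < 1) (hq : ‖q‖ < 1) (m n : ℕ) :
    qPoch (a * q ^ m) q n * (qPoch a q (m + n))⁻¹ = (qPoch a q m)⁻¹ := by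
  have h1 := qPoch_ne_zero ha hq m
  have h2 := qPoch_ne_zero (norm_mul_pow_lt_one hq ha m) hq n
  rw [qPoch_add]
  field_simp

/-- The limiting `q`-Chu-Vandermonde sum. -/
theorem sum_antidiagonal_vandermonde_inv {c q : ℂ} (hc : ‖c‖ < 1) (hq : ‖q‖ < 1) (L : ℕ) :
    ∑ p ∈ Finset.HasAntidiagonal.antidiagonal L, qFactInv q p.1 * qFactInv q p.2
        * (c ^ p.1 * q ^ (2 * p.1.choose 2) * (qPoch c q p.1)⁻¹)
      = qFactInv q L * (qPoch c q L)⁻¹ := by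
  rw [← sum_antidiagonal_vandermonde hq c L, Finset.sum_mul]
  refine Finset.sum_congr rfl fun p hp => ?_
  rw [← qPoch_tail_mul_inv hc hq p.1 p.2, Finset.HasAntidiagonal.mem_antidiagonal.mp hp]
  ring

/-- Chu-Vandermonde with c = -q^{N+1}, after (-q)_{N+m} = (-q)_N (-q^{N+1})_m. It carries out every
m-summation and reproduces the shape 1/((q)_m (-q)_{N+m}). -/
theorem sum_vandermonde_neg {q : ℂ} (hq : ‖q‖ < 1) (M N : ℕ) :
    ∑ m ∈ Finset.range (M + 1), qFactSubInv q M m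
        * ((-1) ^ m * q ^ (m ^ 2 + m * N) * qFactInv q m * (qPoch (-q) q (N + m))⁻¹)
      = qFactInv q M * (qPoch (-q) q (N + M))⁻¹ := by
  have h := sum_range_qFactSubInv q
    (fun m => (-1) ^ m * q ^ (m ^ 2 + m * N) * (qPoch (-q) q (N + m))⁻¹) 0 M
  simp only [zero_add, qFactSubInv_zero] at h
  have h2 := sum_antidiagonal_vandermonde_inv
    (norm_mul_pow_lt_one hq (norm_neg_lt_one hq) N) hq M
  trans (qPoch (-q) q N)⁻¹ * (qFactInv q M * (qPoch (-q * q ^ N) q M)⁻¹)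
  · rw [← h2, Finset.mul_sum]
    trans ∑ j ∈ Finset.range (M + 1), qFactSubInv q M j * qFactInv q j *
        ((-1) ^ j * q ^ (j ^ 2 + j * N) * (qPoch (-q) q (N + j))⁻¹)
    · exact Finset.sum_congr rfl fun m _ => by ring
    · rw [h]
      refine Finset.sum_congr rfl fun p _ => ?_
      rw [qPoch_add, sq_eq_add_two_mul_choose, mul_inv, neg_mul, neg_pow (q * q ^ N)]
      ring
  · rw [qPoch_add, mul_inv]
    ring

/-- Chu-Vandermonde with c = q^{2r+1} after the shift j = r + s; this is the kernel of the Bailey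
lemma at a = 1. -/
theorem sum_vandermonde_sq {q : ℂ} (hq : ‖q‖ < 1) (M r : ℕ) :
    ∑ j ∈ Finset.range (M + 1), qFactSubInv q M j * qFactSubInv q j r
        * (q ^ j ^ 2 * qFactInv q (j + r))
      = q ^ r ^ 2 * qFactSubInv q M r * qFactInv q (M + r) := by
  rcases lt_or_ge M r with h | h
  · rw [sum_range_qFactSubInv_of_lt q _ h, qFactSubInv_of_lt h]
    ring
  · obtain ⟨L, rfl⟩ := Nat.exists_eq_add_of_le h
    have h2 := sum_antidiagonal_vandermonde_inv (norm_mul_pow_lt_one hq hq (2 * r)) hq L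
    have h3 : ∀ s, qFactInv q (r + s + r)
        = (qPoch q q (2 * r))⁻¹ * (qPoch (q * q ^ (2 * r)) q s)⁻¹ := fun s => by
      rw [qFactInv, show r + s + r = 2 * r + s by ring, qPoch_add, mul_inv]
    rw [sum_range_qFactSubInv, qFactSubInv_add, h3]
    trans q ^ r ^ 2 * (qPoch q q (2 * r))⁻¹ * (qFactInv q L * (qPoch (q * q ^ (2 * r)) q L)⁻¹)
    · rw [← h2, Finset.mul_sum]
      refine Finset.sum_congr rfl fun p _ => ?_
      rw [h3, show (r + p.1) ^ 2 = r ^ 2 + 2 * r * p.1 + p.1 ^ 2 by ring,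
        sq_eq_add_two_mul_choose p.1]
      ring
    · ring

/-- `sum_antidiagonal_transform` with a = -q^n and x = q^{m+n+1}. It handles the n-summation: the
factor (-q)_{N+m} it creates cancels the one in `chainBasis`, leaving (-q)_{j+m} in its place. -/
theorem sum_range_transform {q : ℂ} (hq : ‖q‖ < 1) (m n N : ℕ) :
    q ^ n ^ 2 * ∑ j ∈ Finset.range (N + 1), qFactSubInv q N j * qFactSubInv q j n
        * (qPoch (-1) q j * q ^ ((j + 1).choose 2 + m * j))
      = ∑ j ∈ Finset.range (N + 1), qFactSubInv q N j * qFactSubInv q j n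
        * (qPoch (-1) q n * q ^ (n + 1).choose 2 * q ^ (j ^ 2 + m * j) * qPoch (-q) q (N + m)
          * (qPoch (-q) q (j + m))⁻¹) := by
  rcases lt_or_ge N n with h | h
  · rw [sum_range_qFactSubInv_of_lt q _ h, sum_range_qFactSubInv_of_lt q _ h, mul_zero]
  · obtain ⟨L, rfl⟩ := Nat.exists_eq_add_of_le h
    rw [sum_range_qFactSubInv, sum_range_qFactSubInv, Finset.mul_sum]
    have h2 := sum_antidiagonal_transform hq (-1 * q ^ n) (q ^ (m + n + 1)) L
    trans qPoch (-1) q n * q ^ (n ^ 2 + (n + 1).choose 2 + m * n) *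
      ∑ p ∈ Finset.HasAntidiagonal.antidiagonal L, qPoch (-1 * q ^ n) q p.1
        * (q ^ (m + n + 1)) ^ p.1 * q ^ p.1.choose 2 * qFactInv q p.1 * qFactInv q p.2
    · rw [Finset.mul_sum]
      refine Finset.sum_congr rfl fun p _ => ?_
      rw [choose_two_add_add_one, choose_two_succ, qPoch_add]
      ring
    · rw [h2, Finset.mul_sum]
      refine Finset.sum_congr rfl fun p hp => ?_
      have h3 := qPoch_ne_zero (norm_neg_lt_one hq) hq (n + p.1 + m)
      rw [show n + L + m = n + p.1 + m + p.2 by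
          rw [← Finset.HasAntidiagonal.mem_antidiagonal.mp hp]; ring,
        qPoch_add (-q) q (n + p.1 + m),
        show -(q ^ (m + n + 1) * q ^ p.1) = -q * q ^ (n + p.1 + m) by ring,
        show -(-1 * q ^ n * q ^ (m + n + 1)) = q ^ (m + 2 * n + 1) by ring,
        show (n + p.1) ^ 2 = n ^ 2 + 2 * n * p.1 + p.1 ^ 2 by ring,
        sq_eq_add_two_mul_choose p.1]
      field_simp
      ring

/-! ### The chain acting on its basis functions. -/

/-- One step of the chain: summation of `F` against `1 / ((q)_{m - i} (q)_{j - n})`. -/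
noncomputable def chainStep (q : ℂ) (F : ℕ → ℕ → ℂ) (m n : ℕ) : ℂ :=
  ∑' p : ℕ × ℕ, qFactSubInv q m p.1 * qFactSubInv q p.2 n * F p.1 p.2

/-- The functions in which the iterated sums are expanded. -/
noncomputable def chainBasis (q : ℂ) (N m n : ℕ) : ℂ :=
  qPoch (-1) q n * q ^ (n + 1).choose 2 * qFactSubInv q N n * qFactInv q m
    * (qPoch (-q) q (N + m))⁻¹

/-- For fixed i, `sum_range_transform` replaces N by j in the denominator; the sum over i is then
`sum_vandermonde_neg` at j. -/
theorem chainStep_chainBasis {q : ℂ} (hq : ‖q‖ < 1) (N m n : ℕ) :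
    q ^ n ^ 2 * chainStep q (fun i j => (-1) ^ i * q ^ (i ^ 2 + i * j) * chainBasis q N i j) m n
      = ∑ j ∈ Finset.range (N + 1), q ^ j ^ 2 * qFactSubInv q N j * chainBasis q j m n := by
  -- The series terminates: 1/(q)_{m-i} forces i ≤ m, and the basis function forces j ≤ N.
  rw [chainStep, tsum_eq_sum (s := Finset.range (m + 1) ×ˢ Finset.range (N + 1))]
  · rw [Finset.sum_product, Finset.mul_sum]
    trans ∑ i ∈ Finset.range (m + 1), ∑ j ∈ Finset.range (N + 1),
      qFactSubInv q N j * qFactSubInv q j n * (qPoch (-1) q n * q ^ (n + 1).choose 2 * q ^ j ^ 2)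
        * (qFactSubInv q m i
          * ((-1) ^ i * q ^ (i ^ 2 + i * j) * qFactInv q i * (qPoch (-q) q (j + i))⁻¹))
    · refine Finset.sum_congr rfl fun i _ => ?_
      have h := sum_range_transform hq i n N
      have h0 := qPoch_ne_zero (norm_neg_lt_one hq) hq (N + i)
      trans qFactSubInv q m i * (-1) ^ i * q ^ i ^ 2 * qFactInv q i * (qPoch (-q) q (N + i))⁻¹
        * (q ^ n ^ 2 * ∑ j ∈ Finset.range (N + 1), qFactSubInv q N j * qFactSubInv q j n
        * (qPoch (-1) q j * q ^ ((j + 1).choose 2 + i * j)))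
      · simp only [Finset.mul_sum]
        refine Finset.sum_congr rfl fun j _ => ?_
        simp only [chainBasis, pow_add]
        ring
      · rw [h, Finset.mul_sum]
        refine Finset.sum_congr rfl fun j _ => ?_
        have h1 := inv_mul_cancel₀ h0
        generalize (qPoch (-q) q (N + i))⁻¹ = y at h1 ⊢
        linear_combination qFactSubInv q N j * qFactSubInv q j n * (qPoch (-1) q n
          * q ^ (n + 1).choose 2 * q ^ j ^ 2) * (qFactSubInv q m i * ((-1) ^ i
          * q ^ (i ^ 2 + i * j) * qFactInv q i * (qPoch (-q) q (j + i))⁻¹)) * h1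
    · rw [Finset.sum_comm]
      refine Finset.sum_congr rfl fun j _ => ?_
      rw [← Finset.mul_sum, sum_vandermonde_neg hq, chainBasis]
      ring
  · rintro ⟨i, j⟩ hp
    simp only [Finset.mem_product, Finset.mem_range, not_and_or, not_lt] at hp
    rcases hp with hp | hp
    · rw [qFactSubInv_of_lt (a := m) (by simpa using hp)]
      ring
    · simp only [chainBasis]
      rw [qFactSubInv_of_lt (a := N) (by simpa using hp)]
      ring

/-! ### Geometric bounds and expansions in the basis functions. -/

/-- Sequences dominated by a multiple of `‖q‖ ^ n`. -/
def GeomBound (q : ℂ) (d : ℕ → ℂ) : Prop := ∃ C : ℝ, 0 ≤ C ∧ ∀ n, ‖d n‖ ≤ C * ‖q‖ ^ n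

/-- Double sequences dominated by a multiple of `‖q‖ ^ (m + n)`. -/
def GeomBound₂ (q : ℂ) (F : ℕ → ℕ → ℂ) : Prop :=
  ∃ C : ℝ, 0 ≤ C ∧ ∀ m n, ‖F m n‖ ≤ C * (‖q‖ ^ m * ‖q‖ ^ n)

/-- The passage to the next sequence in the Bailey chain. -/
noncomputable def baileyStep (q : ℂ) (d : ℕ → ℂ) (j : ℕ) : ℂ :=
  q ^ j ^ 2 * ∑' M, qFactSubInv q M j * d M

/-- The initial sequence of the Bailey chain. -/
noncomputable def baileySeed (q : ℂ) (M : ℕ) : ℂ := qPoch (-1) q M * q ^ (M + 1).choose 2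

theorem exists_common_bound {q : ℂ} (hq : ‖q‖ < 1) :
    ∃ C : ℝ, 0 ≤ C ∧ (∀ n, ‖qPoch (-1) q n‖ ≤ C) ∧ (∀ n, ‖(qPoch (-q) q n)⁻¹‖ ≤ C) ∧
      (∀ n, ‖qFactInv q n‖ ≤ C) ∧ ∀ a b, ‖qFactSubInv q a b‖ ≤ C := by
  obtain ⟨A, hA0, hA⟩ := exists_norm_qPoch_le (-1) hq
  obtain ⟨B, hB0, hB⟩ := exists_norm_inv_qPoch_le (norm_neg_lt_one hq) hq
  obtain ⟨D, hD0, hD, hD'⟩ := exists_norm_qFactSubInv_le hq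
  exact ⟨A + B + D, by positivity, fun n => (hA n).trans (by linarith),
    fun n => (hB n).trans (by linarith), fun n => (hD n).trans (by linarith),
    fun a b => (hD' a b).trans (by linarith)⟩

theorem norm_pow_le_mul {q : ℂ} (hq : ‖q‖ < 1) {e m n : ℕ} (h : m + n ≤ e) :
    ‖q‖ ^ e ≤ ‖q‖ ^ m * ‖q‖ ^ n := by
  rw [← pow_add]
  exact pow_le_pow_of_le_one (norm_nonneg q) hq.le h

theorem norm_pow_le_pow {q : ℂ} (hq : ‖q‖ < 1) {e m : ℕ} (h : m ≤ e) : ‖q‖ ^ e ≤ ‖q‖ ^ m :=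
  pow_le_pow_of_le_one (norm_nonneg q) hq.le h

theorem le_choose_two_succ (n : ℕ) : n ≤ (n + 1).choose 2 := by
  rw [choose_two_succ]
  omega

theorem geomBound_baileySeed {q : ℂ} (hq : ‖q‖ < 1) : GeomBound q (baileySeed q) := by
  obtain ⟨C, hC, h1, -⟩ := exists_common_bound hq
  refine ⟨C, hC, fun n => ?_⟩
  rw [baileySeed, norm_mul, norm_pow]
  gcongr ?_ * ?_
  · exact h1 n
  · exact norm_pow_le_pow hq (le_choose_two_succ n)

theorem geomBound_baileyStep {q : ℂ} (hq : ‖q‖ < 1) {d : ℕ → ℂ} (hd : GeomBound q d) :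
    GeomBound q (baileyStep q d) := by
  obtain ⟨C, hC, -, -, -, h1⟩ := exists_common_bound hq
  obtain ⟨D, hD, h2⟩ := hd
  have hs : Summable fun n => C * D * ‖q‖ ^ n :=
    (summable_geometric_of_lt_one (norm_nonneg q) hq).mul_left _
  refine ⟨∑' n, C * D * ‖q‖ ^ n, tsum_nonneg fun n => by positivity, fun j => ?_⟩
  rw [baileyStep, norm_mul, norm_pow, mul_comm]
  gcongr ?_ * ?_
  · refine tsum_of_norm_bounded hs.hasSum fun n => ?_
    rw [norm_mul, mul_assoc]
    gcongr
    · exact h1 n j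
    · exact h2 n
  · exact norm_pow_le_pow hq (Nat.le_self_pow two_ne_zero j)

theorem exists_norm_chainBasis_le {q : ℂ} (hq : ‖q‖ < 1) :
    ∃ C : ℝ, 0 ≤ C ∧ ∀ N m n, ‖chainBasis q N m n‖ ≤ C * ‖q‖ ^ n := by
  obtain ⟨C, hC, h1, h2, h3, h4⟩ := exists_common_bound hq
  refine ⟨C * C * C * C, by positivity, fun N m n => ?_⟩
  simp only [chainBasis, norm_mul, norm_pow]
  calc _ ≤ C * ‖q‖ ^ n * C * C * C := by
        gcongr ?_ * ?_ * ?_ * ?_ * ?_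
        · exact h1 n
        · exact norm_pow_le_pow hq (le_choose_two_succ n)
        · exact h4 N n
        · exact h3 m
        · exact h2 _
    _ = _ := by ring

theorem geomBound₂_chain {q : ℂ} (hq : ‖q‖ < 1) {F : ℕ → ℕ → ℂ} (hF : GeomBound₂ q F) :
    ∃ C : ℝ, 0 ≤ C ∧ ∀ m n i j,
      ‖qFactSubInv q m i * qFactSubInv q j n * F i j‖ ≤ C * (‖q‖ ^ i * ‖q‖ ^ j) := by
  obtain ⟨C, hC, -, -, -, h1⟩ := exists_common_bound hq
  obtain ⟨D, hD, h2⟩ := hF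
  refine ⟨C * C * D, by positivity, fun m n i j => ?_⟩
  rw [norm_mul, norm_mul, mul_assoc (C * C)]
  gcongr
  · exact h1 m i
  · exact h1 j n
  · exact h2 i j

/-- Linear extension of `chainStep_chainBasis`; the geometric bounds justify both interchanges of
summation. -/
theorem chainStep_tsum_chainBasis {q : ℂ} (hq : ‖q‖ < 1) {d : ℕ → ℂ} (hd : GeomBound q d)
    {F : ℕ → ℕ → ℂ}
    (hF : ∀ m n, F m n = (-1) ^ m * q ^ (m ^ 2 + m * n) * ∑' M, d M * chainBasis q M m n)
    (m n : ℕ) :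
    q ^ n ^ 2 * chainStep q F m n = ∑' j, baileyStep q d j * chainBasis q j m n := by
  obtain ⟨C, hC, -, -, -, h1⟩ := exists_common_bound hq
  obtain ⟨D, hD, h2⟩ := hd
  obtain ⟨B, hB, h3⟩ := exists_norm_chainBasis_le hq
  have hstep : chainStep q F m n = ∑' M, d M * chainStep q
      (fun i j => (-1) ^ i * q ^ (i ^ 2 + i * j) * chainBasis q M i j) m n := by
    simp only [chainStep, ← tsum_mul_left]
    rw [← Summable.tsum_comm]
    · refine tsum_congr fun p => ?_
      rw [hF, ← tsum_mul_left, ← tsum_mul_left]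
      exact tsum_congr fun M => by ring
    · refine summable_of_norm_le_geometric_mul₃ (C := D * (C * C * B)) (norm_nonneg q) hq
        fun M i j => ?_
      simp only [Function.uncurry_apply_pair, norm_mul, norm_pow, norm_neg, norm_one, one_pow,
        one_mul]
      calc _ ≤ D * ‖q‖ ^ M * (C * C * (‖q‖ ^ i * (B * ‖q‖ ^ j))) := by
            gcongr ?_ * (?_ * ?_ * (?_ * ?_))
            · exact h2 M
            · exact h1 m i
            · exact h1 j n
            · exact norm_pow_le_pow hq
                ((Nat.le_self_pow two_ne_zero i).trans (Nat.le_add_right _ _))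
            · exact h3 M i j
        _ = _ := by ring
  rw [hstep, ← tsum_mul_left]
  trans ∑' M, ∑' j, d M * (q ^ j ^ 2 * qFactSubInv q M j * chainBasis q j m n)
  · refine tsum_congr fun M => ?_
    rw [mul_left_comm, chainStep_chainBasis hq, tsum_mul_left,
      tsum_eq_sum (s := Finset.range (M + 1))]
    intro j hj
    rw [qFactSubInv_of_lt (by simpa using hj)]
    ring
  · rw [← Summable.tsum_comm]
    · refine tsum_congr fun j => ?_
      rw [baileyStep, ← tsum_mul_left, ← tsum_mul_right]
      exact tsum_congr fun M => by ring
    · refine summable_of_norm_le_geometric_mul (C := D * (C * B)) (norm_nonneg q) hq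
        fun M j => ?_
      simp only [Function.uncurry_apply_pair, norm_mul, norm_pow]
      calc _ ≤ D * ‖q‖ ^ M * (‖q‖ ^ j * C * (B * 1)) := by
            gcongr ?_ * (?_ * ?_ * ?_)
            · exact h2 M
            · exact norm_pow_le_pow hq (Nat.le_self_pow two_ne_zero j)
            · exact h1 M j
            · exact (h3 j m n).trans (by gcongr; exact pow_le_one₀ (norm_nonneg q) hq.le)
        _ = _ := by ring

/-! ### Summation over the first pair of variables. -/

theorem tsum_qFactSubInv (q : ℂ) (n : ℕ) (g : ℕ → ℂ) :
    ∑' j, qFactSubInv q j n * g j = ∑' t, qFactInv q t * g (n + t) := by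
  rw [← (add_right_injective n).tsum_eq]
  · exact tsum_congr fun t => by rw [qFactSubInv_add]
  · intro j hj
    by_contra h
    refine hj ?_
    have : j < n := by
      by_contra h'
      exact h ⟨j - n, by simp only; omega⟩
    simp only [qFactSubInv_of_lt this, zero_mul]

theorem qPochInf_tail {a q : ℂ} (ha : ‖a‖ < 1) (hq : ‖q‖ < 1) (n : ℕ) :
    qPochInf (a * q ^ n) q = qPochInf a q * (qPoch a q n)⁻¹ := by
  have h := qPoch_ne_zero ha hq n
  rw [qPochInf_eq_mul a hq n]
  field_simp

/-- Heine's transformation with a = b = -q^n and z = q^{m+1}; the tails of (-q)_∞ and (q)_∞ supply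
the prefactor. -/
theorem tsum_seed_transform {q : ℂ} (hq : ‖q‖ < 1) (m n : ℕ) :
    q ^ n ^ 2 * ∑' j, qFactSubInv q j n * (qPoch (-1) q j ^ 2 * q ^ (j * (m + 1)))
      = qPochInf (-q) q / qPochInf q q * qPoch q q m * ∑' M, qFactSubInv q M n
          * (qPoch (-1) q n * q ^ (n + 1).choose 2 * (baileySeed q M * q ^ (m * M)
            * (qPoch (-q) q (M + m))⁻¹)) := by
  rw [tsum_qFactSubInv, tsum_qFactSubInv]
  have ha : ‖-1 * q ^ n‖ ≤ 1 := by
    simpa using pow_le_one₀ (norm_nonneg q) hq.le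
  have hz : ‖q * q ^ m‖ < 1 := norm_mul_pow_lt_one hq hq m
  have h := tsum_heine (b := -1 * q ^ n) ha hq hz
  trans qPoch (-1) q n ^ 2 * q ^ (n ^ 2 + n * (m + 1)) * ∑' t, qPoch (-1 * q ^ n) q t
    * qPoch (-1 * q ^ n) q t * (q * q ^ m) ^ t * qFactInv q t
  · rw [← tsum_mul_left, ← tsum_mul_left]
    refine tsum_congr fun t => ?_
    rw [qPoch_add]
    ring
  · rw [h, ← tsum_mul_left, ← tsum_mul_left]
    refine tsum_congr fun t => ?_
    rw [show -1 * q ^ n * (q * q ^ m) * q ^ t = -q * q ^ (n + t + m) by ring,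
      qPochInf_tail (norm_neg_lt_one hq) hq, qPochInf_tail hq hq, baileySeed,
      choose_two_add_add_one, choose_two_succ, qPoch_add (-1) q n t,
      show -(-1 * q ^ n * (q * q ^ m)) = q ^ (n + m + 1) by ring, sq_eq_add_two_mul_choose n,
      div_mul_eq_div_div, div_inv_eq_mul]
    ring

/-- The weight attached to the first pair of summation variables. -/
noncomputable def chainHead (q : ℂ) (m n : ℕ) : ℂ :=
  (-1) ^ m * q ^ (m ^ 2 + m * n + n) * qPoch (-1) q n ^ 2 * qFactInv q m ^ 2

theorem geomBound₂_chainHead {q : ℂ} (hq : ‖q‖ < 1) : GeomBound₂ q (chainHead q) := by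
  obtain ⟨C, hC, h1, -, h3, -⟩ := exists_common_bound hq
  refine ⟨C ^ 2 * C ^ 2, by positivity, fun m n => ?_⟩
  simp only [chainHead, norm_mul, norm_pow, norm_neg, norm_one, one_pow, one_mul]
  calc _ ≤ ‖q‖ ^ m * ‖q‖ ^ n * C ^ 2 * C ^ 2 := by
        gcongr ?_ * ?_ ^ 2 * ?_ ^ 2
        · exact norm_pow_le_mul hq (by nlinarith [Nat.le_self_pow two_ne_zero m])
        · exact h1 n
        · exact h3 m
    _ = _ := by ring

theorem summable_chain {q : ℂ} (hq : ‖q‖ < 1) {F : ℕ → ℕ → ℂ} (hF : GeomBound₂ q F) (m n : ℕ) :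
    Summable fun p : ℕ × ℕ => qFactSubInv q m p.1 * qFactSubInv q p.2 n * F p.1 p.2 := by
  obtain ⟨C, hC, h⟩ := geomBound₂_chain hq hF
  exact summable_of_norm_le_geometric_mul (norm_nonneg q) hq (h m n)

/-- The factor (q)_i from `tsum_seed_transform` cancels one of the two 1/(q)_i in `chainHead`, which
is what lets `sum_vandermonde_neg` sum over i. -/
theorem chainStep_chainHead {q : ℂ} (hq : ‖q‖ < 1) (m n : ℕ) :
    q ^ n ^ 2 * chainStep q (chainHead q) m n
      = ∑' M, qPochInf (-q) q / qPochInf q q * baileySeed q M * chainBasis q M m n := by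
  obtain ⟨C, hC, h1, h2, -, h4⟩ := exists_common_bound hq
  obtain ⟨D, hD, h5⟩ := geomBound_baileySeed hq
  rw [chainStep, (summable_chain hq (geomBound₂_chainHead hq) m n).tsum_prod,
    tsum_eq_sum (s := Finset.range (m + 1))]
  · trans ∑ i ∈ Finset.range (m + 1), ∑' M, qPochInf (-q) q / qPochInf q q * baileySeed q M
      * (qPoch (-1) q n * q ^ (n + 1).choose 2) * qFactSubInv q M n * (qFactSubInv q m i
        * ((-1) ^ i * q ^ (i ^ 2 + i * M) * qFactInv q i * (qPoch (-q) q (M + i))⁻¹))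
    · rw [Finset.mul_sum]
      refine Finset.sum_congr rfl fun i _ => ?_
      trans qFactSubInv q m i * (-1) ^ i * q ^ i ^ 2 * qFactInv q i ^ 2 *
        (q ^ n ^ 2 * ∑' j, qFactSubInv q j n * (qPoch (-1) q j ^ 2 * q ^ (j * (i + 1))))
      · rw [← tsum_mul_left, ← tsum_mul_left, ← tsum_mul_left]
        refine tsum_congr fun j => ?_
        simp only [chainHead]
        ring
      · have h0 : qFactInv q i * qPoch q q i = 1 := inv_mul_cancel₀ (qPoch_ne_zero hq hq i)
        rw [tsum_seed_transform hq, ← tsum_mul_left, ← tsum_mul_left]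
        refine tsum_congr fun M => ?_
        trans (qFactInv q i * qPoch q q i) * (qPochInf (-q) q / qPochInf q q * baileySeed q M
          * (qPoch (-1) q n * q ^ (n + 1).choose 2) * qFactSubInv q M n * (qFactSubInv q m i
          * ((-1) ^ i * q ^ (i ^ 2 + i * M) * qFactInv q i * (qPoch (-q) q (M + i))⁻¹)))
        · ring
        · rw [h0, one_mul]
    · rw [← Summable.tsum_finsetSum]
      · refine tsum_congr fun M => ?_
        rw [← Finset.mul_sum, sum_vandermonde_neg hq, chainBasis]
        ring
      · intro i _
        refine summable_of_norm_le_geometric (C := ‖qPochInf (-q) q / qPochInf q q‖ * D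
          * ‖qPoch (-1) q n * q ^ (n + 1).choose 2‖ * C * (‖qFactSubInv q m i‖
            * (‖qFactInv q i‖ * C))) (norm_nonneg q) hq fun M => ?_
        simp only [norm_mul, norm_pow, norm_neg, norm_one, one_pow, one_mul]
        calc _ ≤ ‖qPochInf (-q) q / qPochInf q q‖ * (D * ‖q‖ ^ M)
          * (‖qPoch (-1) q n‖ * ‖q‖ ^ (n + 1).choose 2) * C * (‖qFactSubInv q m i‖
            * (1 * ‖qFactInv q i‖ * C)) := by
              gcongr ?_ * ?_ * _ * ?_ * (_ * (?_ * _ * ?_))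
              · exact h5 M
              · exact h4 M n
              · exact pow_le_one₀ (norm_nonneg q) hq.le
              · exact h2 _
          _ = _ := by ring
  · intro i hi
    have h : qFactSubInv q m i = 0 := qFactSubInv_of_lt (by simpa using hi)
    simp [h]

/-! ### Conjugate sequences and the unit Bailey pair. -/

/-- The sequence conjugate to `d` under the Bailey transform with parameter `1`. -/
noncomputable def baileyConj (q : ℂ) (d : ℕ → ℂ) (r : ℕ) : ℂ :=
  ∑' j, qFactSubInv q j r * (d j * qFactInv q (j + r))

theorem baileyConj_baileyStep {q : ℂ} (hq : ‖q‖ < 1) {d : ℕ → ℂ} (hd : GeomBound q d) (r : ℕ) :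
    baileyConj q (baileyStep q d) r = q ^ r ^ 2 * baileyConj q d r := by
  obtain ⟨C, hC, -, -, h3, h4⟩ := exists_common_bound hq
  obtain ⟨D, hD, h2⟩ := hd
  trans ∑' j, ∑' M, d M * (qFactSubInv q M j * qFactSubInv q j r
    * (q ^ j ^ 2 * qFactInv q (j + r)))
  · refine tsum_congr fun j => ?_
    rw [baileyStep, mul_right_comm, ← mul_assoc, ← tsum_mul_left]
    exact tsum_congr fun M => by ring
  · rw [Summable.tsum_comm]
    · rw [baileyConj, ← tsum_mul_left]
      refine tsum_congr fun M => ?_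
      rw [tsum_mul_left, tsum_eq_sum (s := Finset.range (M + 1)), sum_vandermonde_sq hq]
      · ring
      · intro j hj
        rw [qFactSubInv_of_lt (b := j) (by simpa using hj)]
        ring
    · refine summable_of_norm_le_geometric_mul (C := D * (C * C * C)) (norm_nonneg q) hq
        fun M j => ?_
      simp only [Function.uncurry_apply_pair, norm_mul, norm_pow]
      calc _ ≤ D * ‖q‖ ^ M * (C * C * (‖q‖ ^ j * C)) := by
            gcongr ?_ * (?_ * ?_ * (?_ * ?_))
            · exact h2 M
            · exact h4 M j
            · exact h4 j r
            · exact norm_pow_le_pow hq (Nat.le_self_pow two_ne_zero j)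
            · exact h3 _
        _ = _ := by ring

theorem qPoch_one_zero_tail (q : ℂ) (n : ℕ) : qPoch 1 q n = if n = 0 then 1 else 0 := by
  cases n with
  | zero => simp [qPoch_zero]
  | succ n => simp [qPoch_one_succ]

/-- Heine's transformation read backwards, with a = 1, b = -q^r, z = -q^{r+1}: its left side is just
1. -/
theorem baileyConj_baileySeed {q : ℂ} (hq : ‖q‖ < 1) (r : ℕ) :
    baileyConj q (baileySeed q) r = qPochInf (-q) q / qPochInf q q
      * (qPoch (-1) q r * q ^ (r + 1).choose 2 * (qPoch (-q) q r)⁻¹) := by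
  have hz : ‖-q * q ^ r‖ < 1 := norm_mul_pow_lt_one hq (norm_neg_lt_one hq) r
  have h := tsum_heine (a := 1) (b := -1 * q ^ r) (by simp) hq hz
  rw [tsum_eq_single 0 fun n hn => by simp [qPoch_one_zero_tail, hn]] at h
  simp only [qPoch_zero, qFactInv_zero, pow_zero, one_mul, mul_one] at h
  have h2 := qPochInf_ne_zero hq hq
  have h5 : qPochInf (-q * q ^ r) q * (qPochInf q q)⁻¹
      * (qPochInf q q * (qPochInf (-q * q ^ r) q)⁻¹) = 1 := by
    have h6 := qPochInf_ne_zero hz hq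
    generalize qPochInf (-q * q ^ r) q = y at h6
    field_simp
  rw [baileyConj, tsum_qFactSubInv]
  trans (qPoch (-1) q r * q ^ (r + 1).choose 2) * (qPochInf (-q * q ^ r) q * (qPochInf q q)⁻¹)
  · refine Eq.trans ?_ ((congrArg ((qPoch (-1) q r * q ^ (r + 1).choose 2)
      * (qPochInf (-q * q ^ r) q * (qPochInf q q)⁻¹) * ·) h).symm.trans (mul_one _))
    rw [← tsum_mul_left]
    refine tsum_congr fun t => ?_
    rw [baileySeed, show -1 * q ^ r * (-q * q ^ r) * q ^ t = q * q ^ (r + t + r) by ring,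
      qPochInf_tail hq hq, choose_two_add_add_one, choose_two_succ, qPoch_add (-1) q r t,
      div_eq_mul_inv, neg_mul q, neg_neg, ← qFactInv]
    trans (qPoch (-1) q r * qPoch (-1 * q ^ r) q t * qFactInv q t * qFactInv q (r + t + r)
      * q ^ (r.choose 2 + t.choose 2 + r * t + r + t))
      * (qPochInf (-q * q ^ r) q * (qPochInf q q)⁻¹
        * (qPochInf q q * (qPochInf (-q * q ^ r) q)⁻¹))
    · rw [h5]
      ring
    · rw [neg_mul q]
      ring
  · rw [qPochInf_tail (norm_neg_lt_one hq) hq]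
    ring

/-- The sequence `α` of the unit Bailey pair with parameter `1`. -/
noncomputable def unitBailey (q : ℂ) (r : ℕ) : ℂ :=
  if r = 0 then 1 else (-1) ^ r * q ^ r.choose 2 * (1 + q ^ r)

/-- Truncated sums have a closed form, with upper index R + u kept fixed while R grows, so the
induction uses u + 1. At u = 0 the factor 1 - q^u kills the full sum. -/
theorem sum_unitBailey_partial {q : ℂ} (hq : ‖q‖ < 1) (R u : ℕ) :
    (1 - q ^ (R + u)) * ∑ r ∈ Finset.range (R + 1),
        unitBailey q r * (qFactSubInv q (R + u) r * qFactInv q (R + u + r))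
      = (-1) ^ R * q ^ (R + 1).choose 2 * (1 - q ^ u) * qFactInv q u
        * qFactInv q (R + u + R) := by
  induction R generalizing u with
  | zero =>
    simp only [unitBailey, zero_add, Finset.sum_range_one, if_pos, qFactSubInv_zero, add_zero,
      pow_zero, Nat.choose_eq_zero_of_lt one_lt_two]
    ring
  | succ R ih =>
    have h := ih (u + 1)
    rw [show R + (u + 1) = R + 1 + u by ring] at h
    rw [Finset.sum_range_succ, mul_add, h, qFactSubInv_add, unitBailey, if_neg R.succ_ne_zero,
      mul_assoc _ (1 - q ^ (u + 1)), one_sub_mul_qFactInv_succ hq,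
      ← one_sub_mul_qFactInv_succ hq (R + 1 + u + R), choose_two_succ (R + 1)]
    simp only [pow_add, pow_one]
    ring_nf

theorem sum_unitBailey {q : ℂ} (hq : ‖q‖ < 1) (j : ℕ) :
    ∑ r ∈ Finset.range (j + 1), unitBailey q r * (qFactSubInv q j r * qFactInv q (j + r))
      = if j = 0 then 1 else 0 := by
  split_ifs with hj
  · subst hj
    simp [unitBailey, qFactSubInv_zero, qFactInv_zero]
  · obtain ⟨i, rfl⟩ := Nat.exists_eq_succ_of_ne_zero hj
    have h := sum_unitBailey_partial hq (i + 1) 0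
    rw [pow_zero, sub_self, mul_zero, zero_mul, zero_mul] at h
    exact (mul_eq_zero.mp h).resolve_left
      (one_sub_ne_zero_of_norm_lt (norm_pow_succ_lt_one hq i))

/-- After interchanging the sums, the coefficient of d_j is the β_j of the unit Bailey pair, which
is δ_{j,0}. -/
theorem tsum_unitBailey_mul_baileyConj {q : ℂ} (hq : ‖q‖ < 1) {d : ℕ → ℂ} (hd : GeomBound q d) :
    ∑' r, unitBailey q r * baileyConj q d r = d 0 := by
  obtain ⟨C, hC, -, -, h3, h4⟩ := exists_common_bound hq
  obtain ⟨D, hD, h2⟩ := hd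
  trans ∑' r, ∑' j, d j * (unitBailey q r * (qFactSubInv q j r * qFactInv q (j + r)))
  · refine tsum_congr fun r => ?_
    rw [baileyConj, ← tsum_mul_left]
    exact tsum_congr fun j => by ring
  · rw [Summable.tsum_comm]
    · rw [tsum_eq_single 0]
      · rw [tsum_mul_left, tsum_eq_sum (s := Finset.range (0 + 1)), sum_unitBailey hq, if_pos rfl,
          mul_one]
        intro r hr
        rw [qFactSubInv_of_lt (by simpa [Nat.pos_iff_ne_zero] using hr)]
        ring
      · intro j hj
        rw [tsum_mul_left, tsum_eq_sum (s := Finset.range (j + 1)), sum_unitBailey hq, if_neg hj,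
          mul_zero]
        intro r hr
        rw [qFactSubInv_of_lt (by simpa using hr)]
        ring
    -- The exponent r would be too large: r(r-1)/2 ≥ r fails at r = 1, 2. Truncated subtraction
    -- covers r = 0.
    · have hunit : ∀ r, ‖unitBailey q r‖ ≤ 2 * ‖q‖ ^ (r - 1) := by
        intro r
        unfold unitBailey
        split_ifs with hr
        · subst hr
          simp
        · have h1 : ‖1 + q ^ r‖ ≤ 2 := by
            refine (norm_add_le _ _).trans ?_
            rw [norm_one, norm_pow]
            linarith [pow_le_one₀ (n := r) (norm_nonneg q) hq.le]
          have h2 : r - 1 ≤ r.choose 2 := by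
            obtain ⟨s, rfl⟩ := Nat.exists_eq_succ_of_ne_zero hr
            exact le_choose_two_succ s
          simp only [norm_mul, norm_pow, norm_neg, norm_one, one_pow, one_mul]
          rw [mul_comm]
          gcongr ?_ * ?_
          exact norm_pow_le_pow hq h2
      have hs : Summable fun r : ℕ => ‖q‖ ^ (r - 1) := by
        rw [← summable_nat_add_iff 1]
        simpa using summable_geometric_of_lt_one (norm_nonneg q) hq
      refine .of_norm_bounded (((summable_geometric_of_lt_one (norm_nonneg q) hq).mul_of_nonneg
        hs (fun _ => by positivity)
        (fun _ => by positivity)).mul_left (2 * D * C * C)) fun p => ?_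
      obtain ⟨j, r⟩ := p
      simp only [Function.uncurry_apply_pair, norm_mul]
      calc _ ≤ D * ‖q‖ ^ j * (2 * ‖q‖ ^ (r - 1) * (C * C)) := by
            gcongr ?_ * (?_ * (?_ * ?_))
            · exact h2 j
            · exact hunit r
            · exact h4 j r
            · exact h3 _
        _ = _ := by ring

/-! ### Evaluation by the theta series. -/

/-- The coefficients of the theta series `∑ (-1)^r q^{r²}` folded onto `r ≥ 0`. -/
noncomputable def thetaCoeff (r : ℕ) : ℂ := if r = 0 then 1 else 2 * (-1) ^ r

/-- For r ≥ 1, (-1)_r (1 + q^r) = 2 (-q)_r, and the two triangular exponents add up to r². -/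
theorem unitBailey_mul_seed {q : ℂ} (hq : ‖q‖ < 1) (r : ℕ) :
    unitBailey q r * (qPoch (-1) q r * q ^ (r + 1).choose 2 * (qPoch (-q) q r)⁻¹)
      = thetaCoeff r * q ^ r ^ 2 := by
  cases r with
  | zero => simp [unitBailey, thetaCoeff, qPoch_zero]
  | succ r =>
    have h0 := qPoch_ne_zero (norm_neg_lt_one hq) hq (r + 1)
    have h1 : qPoch (-1) q (r + 1) * (1 + q ^ (r + 1)) = 2 * qPoch (-q) q (r + 1) := by
      rw [add_comm r 1, qPoch_add, add_comm 1 r, qPoch_succ (-q)]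
      rw [show -1 * q ^ 1 = -q by ring]
      simp only [qPoch, Finset.prod_range_one, pow_zero, pow_succ]
      ring
    rw [unitBailey, thetaCoeff, if_neg r.succ_ne_zero, if_neg r.succ_ne_zero,
      choose_two_succ (r + 1), sq_eq_add_two_mul_choose (r + 1)]
    trans (-1) ^ (r + 1) * q ^ (r + 1 + 2 * (r + 1).choose 2)
      * (qPoch (-1) q (r + 1) * (1 + q ^ (r + 1))) * (qPoch (-q) q (r + 1))⁻¹
    · ring
    · rw [h1]
      field_simp

theorem geomBound_iterate {q : ℂ} (hq : ‖q‖ < 1) (k : ℕ) :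
    GeomBound q ((baileyStep q)^[k] (baileySeed q)) := by
  induction k with
  | zero => exact geomBound_baileySeed hq
  | succ k ih =>
    rw [Function.iterate_succ_apply']
    exact geomBound_baileyStep hq ih

theorem baileyConj_iterate {q : ℂ} (hq : ‖q‖ < 1) (k r : ℕ) :
    baileyConj q ((baileyStep q)^[k] (baileySeed q)) r
      = (q ^ r ^ 2) ^ k * baileyConj q (baileySeed q) r := by
  induction k with
  | zero => simp
  | succ k ih =>
    rw [Function.iterate_succ_apply', baileyConj_baileyStep hq (geomBound_iterate hq k), ih]
    ring

/-- Each of the k steps contributes q^{r²} and the seed contributes one more, hence the base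
q^{k+1}. -/
theorem iterate_baileyStep_zero {q : ℂ} (hq : ‖q‖ < 1) (k : ℕ) :
    (baileyStep q)^[k] (baileySeed q) 0 = qPochInf (-q) q / qPochInf q q
      * ∑' r, thetaCoeff r * (q ^ (k + 1)) ^ r ^ 2 := by
  rw [← tsum_unitBailey_mul_baileyConj hq (geomBound_iterate hq k), ← tsum_mul_left]
  refine tsum_congr fun r => ?_
  rw [baileyConj_iterate hq, baileyConj_baileySeed hq]
  trans qPochInf (-q) q / qPochInf q q * (q ^ r ^ 2) ^ k * (unitBailey q r
    * (qPoch (-1) q r * q ^ (r + 1).choose 2 * (qPoch (-q) q r)⁻¹))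
  · ring
  · rw [unitBailey_mul_seed hq]
    ring

/-- Gauss's product for the theta series. -/
theorem tsum_thetaCoeff {q : ℂ} (hq : ‖q‖ < 1) :
    ∑' r, thetaCoeff r * q ^ r ^ 2 = qPochInf q q / qPochInf (-q) q := by
  -- With no steps, term 0 is the seed's value 1, so the theta series is forced to equal 1/c.
  have h := iterate_baileyStep_zero hq 0
  simp only [Function.iterate_zero, id_eq, zero_add, pow_one, baileySeed, qPoch_zero,
    Nat.choose_eq_zero_of_lt one_lt_two, pow_zero, one_mul] at h
  have h1 := qPochInf_ne_zero (norm_neg_lt_one hq) hq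
  have h2 := qPochInf_ne_zero hq hq
  rw [eq_div_iff h1]
  field_simp at h
  rw [mul_comm, ← h]

theorem qPochInf_sq_sq {q : ℂ} (hq : ‖q‖ < 1) :
    qPochInf (q ^ 2) (q ^ 2) = qPochInf q q * qPochInf (-q) q := by
  have h := (multipliable_qPochInf q hq).tprod_mul (multipliable_qPochInf (-q) hq)
  rw [qPochInf, qPochInf, qPochInf, ← h]
  exact tprod_congr fun j => by ring

/-! ### Iterating the chain and closing it. -/

/-- Passage from the weight of one pair of summation variables to that of the next pair. -/
noncomputable def chainNext (q : ℂ) (F : ℕ → ℕ → ℂ) (m n : ℕ) : ℂ :=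
  (-1) ^ m * q ^ (m ^ 2 + m * n + n ^ 2) * chainStep q F m n

/-- The sum over the last pair of summation variables. -/
noncomputable def chainEnd (q : ℂ) (F : ℕ → ℕ → ℂ) : ℂ :=
  ∑' p : ℕ × ℕ, F p.1 p.2 * qFactInv q p.2

theorem norm_chainWeight_le {q : ℂ} (hq : ‖q‖ < 1) (m n : ℕ) :
    ‖(-1) ^ m * q ^ (m ^ 2 + m * n + n ^ 2)‖ ≤ ‖q‖ ^ m * ‖q‖ ^ n := by
  simp only [norm_mul, norm_pow, norm_neg, norm_one, one_pow, one_mul]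
  have hm := Nat.le_self_pow two_ne_zero m
  have hn := Nat.le_self_pow two_ne_zero n
  exact norm_pow_le_mul hq (by linarith [Nat.zero_le (m * n)])

theorem geomBound₂_chainNext {q : ℂ} (hq : ‖q‖ < 1) {F : ℕ → ℕ → ℂ} (hF : GeomBound₂ q F) :
    GeomBound₂ q (chainNext q F) := by
  obtain ⟨C, hC, h⟩ := geomBound₂_chain hq hF
  have hs := summable_geometric_mul (norm_nonneg q) hq C
  refine ⟨∑' p : ℕ × ℕ, C * (‖q‖ ^ p.1 * ‖q‖ ^ p.2), tsum_nonneg fun p => by positivity,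
    fun m n => ?_⟩
  rw [chainNext, norm_mul, mul_comm]
  gcongr ?_ * ?_
  · exact tsum_of_norm_bounded hs.hasSum fun p => h m n p.1 p.2
  · exact norm_chainWeight_le hq m n

theorem geomBound₂_iterate {q : ℂ} (hq : ‖q‖ < 1) {F : ℕ → ℕ → ℂ} (hF : GeomBound₂ q F) (k : ℕ) :
    GeomBound₂ q ((chainNext q)^[k] F) := by
  induction k with
  | zero => exact hF
  | succ k ih =>
    rw [Function.iterate_succ_apply']
    exact geomBound₂_chainNext hq ih

/-- The q^{n²} in `chainNext` is exactly the factor the previous expansion needs, so the weight left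
over is the one in `chainStep_tsum_chainBasis`. -/
theorem chainStep_iterate {q : ℂ} (hq : ‖q‖ < 1) (k m n : ℕ) :
    q ^ n ^ 2 * chainStep q ((chainNext q)^[k] (chainHead q)) m n
      = ∑' M, qPochInf (-q) q / qPochInf q q * (baileyStep q)^[k] (baileySeed q) M
          * chainBasis q M m n := by
  induction k generalizing m n with
  | zero => exact chainStep_chainHead hq m n
  | succ k ih =>
    have hd : GeomBound q fun M =>
        qPochInf (-q) q / qPochInf q q * (baileyStep q)^[k] (baileySeed q) M := by
      obtain ⟨C, hC, h⟩ := geomBound_iterate hq k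
      refine ⟨‖qPochInf (-q) q / qPochInf q q‖ * C, by positivity, fun M => ?_⟩
      rw [norm_mul, mul_assoc]
      gcongr
      exact h M
    rw [Function.iterate_succ_apply', chainStep_tsum_chainBasis hq hd]
    · refine tsum_congr fun j => ?_
      rw [Function.iterate_succ_apply', baileyStep, baileyStep, ← tsum_mul_left, ← tsum_mul_left,
        ← tsum_mul_left]
      congr 1
      exact tsum_congr fun M => by ring
    · intro i j
      rw [← ih, chainNext, pow_add q (i ^ 2 + i * j)]
      ring

open Filter Topology in
theorem tendsto_qFactInv {q : ℂ} (hq : ‖q‖ < 1) :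
    Tendsto (qFactInv q) atTop (𝓝 (qPochInf q q)⁻¹) :=
  (tendsto_qPoch q hq).inv₀ (qPochInf_ne_zero hq hq)

open Filter Topology in
theorem tendsto_qFactSubInv {q : ℂ} (hq : ‖q‖ < 1) (i : ℕ) :
    Tendsto (fun m => qFactSubInv q m i) atTop (𝓝 (qPochInf q q)⁻¹) := by
  refine ((tendsto_qFactInv hq).comp (tendsto_sub_atTop_nat i)).congr' ?_
  filter_upwards [eventually_ge_atTop i] with m hm
  simp [qFactSubInv, hm]

open Filter Topology in
theorem tendsto_chainStep {q : ℂ} (hq : ‖q‖ < 1) {F : ℕ → ℕ → ℂ} (hF : GeomBound₂ q F) :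
    Tendsto (fun m => chainStep q F m 0) atTop (𝓝 ((qPochInf q q)⁻¹ * chainEnd q F)) := by
  obtain ⟨C, hC, h⟩ := geomBound₂_chain hq hF
  rw [chainEnd, ← tsum_mul_left]
  refine tendsto_tsum_of_dominated_convergence
    (summable_geometric_mul (norm_nonneg q) hq C) (fun p => ?_)
    (Eventually.of_forall fun m p => h m 0 p.1 p.2)
  have h1 := (tendsto_qFactSubInv hq p.1).mul_const (qFactSubInv q p.2 0 * F p.1 p.2)
  rw [qFactSubInv_zero, mul_comm (qFactInv q p.2)] at h1
  refine h1.congr fun m => ?_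
  rw [qFactSubInv_zero]
  ring

-- The limit m → ∞ of `chainStep` at n = 0 is computed twice: directly, and through the basis
-- expansion by dominated convergence.
open Filter Topology in
theorem chainEnd_iterate {q : ℂ} (hq : ‖q‖ < 1) (k : ℕ) :
    chainEnd q ((chainNext q)^[k] (chainHead q))
      = (qPochInf q q)⁻¹ * (baileyStep q)^[k + 1] (baileySeed q) 0 := by
  obtain ⟨C, hC, -, h2, h3, h4⟩ := exists_common_bound hq
  obtain ⟨D, hD, h5⟩ := geomBound_iterate hq k
  have hP := qPochInf_ne_zero hq hq
  have hP' := qPochInf_ne_zero (norm_neg_lt_one hq) hq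
  set c := qPochInf (-q) q / qPochInf q q with hc
  have hlim : Tendsto (fun m => chainStep q ((chainNext q)^[k] (chainHead q)) m 0) atTop
      (𝓝 (∑' M, c * (baileyStep q)^[k] (baileySeed q) M
        * (qFactSubInv q M 0 * (qPochInf q q)⁻¹ * (qPochInf (-q) q)⁻¹))) := by
    have heq : ∀ m, ∑' M, c * (baileyStep q)^[k] (baileySeed q) M
        * (qFactSubInv q M 0 * qFactInv q m * (qPoch (-q) q (M + m))⁻¹)
        = chainStep q ((chainNext q)^[k] (chainHead q)) m 0 := by
      intro m
      have h := chainStep_iterate hq k m 0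
      rw [zero_pow two_ne_zero, pow_zero, one_mul] at h
      rw [h]
      refine tsum_congr fun M => ?_
      simp only [chainBasis, qPoch_zero, zero_add, Nat.choose_eq_zero_of_lt one_lt_two, pow_zero,
        one_mul]
      rfl
    refine Tendsto.congr heq ?_
    refine tendsto_tsum_of_dominated_convergence
      (bound := fun M => ‖c‖ * D * (C * C * C) * ‖q‖ ^ M)
      ((summable_geometric_of_lt_one (norm_nonneg q) hq).mul_left _) (fun M => ?_)
      (Eventually.of_forall fun m M => ?_)
    · refine Tendsto.const_mul _ (((tendsto_qFactInv hq).const_mul _).mul ?_)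
      refine Tendsto.inv₀ ?_ hP'
      have h := (tendsto_add_atTop_iff_nat (f := qPoch (-q) q) M).mpr (tendsto_qPoch (-q) hq)
      exact h.congr fun m => by rw [add_comm]
    · simp only [norm_mul]
      calc _ ≤ ‖c‖ * (D * ‖q‖ ^ M) * (C * C * C) := by
            gcongr _ * ?_ * (?_ * ?_ * ?_)
            · exact h5 M
            · exact h4 M 0
            · exact h3 m
            · exact h2 _
        _ = _ := by ring
  have h := tendsto_nhds_unique
    (tendsto_chainStep hq (geomBound₂_iterate hq (geomBound₂_chainHead hq) k)) hlim
  -- Summing against 1/(q)_M is one more `baileyStep` read at index 0, and c/(-q)_∞ = 1/(q)_∞.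
  have h6 : ∑' M, c * (baileyStep q)^[k] (baileySeed q) M
        * (qFactSubInv q M 0 * (qPochInf q q)⁻¹ * (qPochInf (-q) q)⁻¹)
      = (qPochInf q q)⁻¹ * ((qPochInf q q)⁻¹ * (baileyStep q)^[k + 1] (baileySeed q) 0) := by
    rw [Function.iterate_succ_apply', baileyStep, ← tsum_mul_left, ← tsum_mul_left,
      ← tsum_mul_left]
    refine tsum_congr fun M => ?_
    rw [hc, zero_pow two_ne_zero, pow_zero]
    field_simp
  rw [h6] at h
  exact mul_left_cancel₀ (inv_ne_zero hP) h

/-! ### The multiple series as an iterated chain. -/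

/-- The summand of the iterated sum with initial weight `F`. -/
noncomputable def chainTerm (q : ℂ) (K : ℕ) (F : ℕ → ℕ → ℂ)
    (p : (Fin (K + 1) → ℕ) × (Fin (K + 1) → ℕ)) : ℂ :=
  F (p.1 0) (p.2 0)
    * (∏ i : Fin K, qFactSubInv q (p.1 i.succ) (p.1 i.castSucc)
        * qFactSubInv q (p.2 i.castSucc) (p.2 i.succ)
        * ((-1) ^ p.1 i.succ
          * q ^ (p.1 i.succ ^ 2 + p.1 i.succ * p.2 i.succ + p.2 i.succ ^ 2)))
    * qFactInv q (p.2 (Fin.last K))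

theorem summable_prod_pow {r : ℝ} (hr0 : 0 ≤ r) (hr : r < 1) (K : ℕ) :
    Summable fun f : Fin K → ℕ => ∏ i, r ^ f i := by
  induction K with
  | zero => exact Summable.of_finite
  | succ K ih =>
    rw [← (Fin.consEquiv fun _ : Fin (K + 1) => ℕ).summable_iff]
    refine ((summable_geometric_of_lt_one hr0 hr).mul_of_nonneg ih (fun _ => pow_nonneg hr0 _)
      (fun _ => Finset.prod_nonneg fun _ _ => pow_nonneg hr0 _)).congr fun p => ?_
    simp [Fin.consEquiv, Fin.prod_univ_succ]

theorem summable_chainTerm {q : ℂ} (hq : ‖q‖ < 1) (K : ℕ) {F : ℕ → ℕ → ℂ}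
    (hF : GeomBound₂ q F) : Summable (chainTerm q K F) := by
  obtain ⟨C, hC, -, -, h3, h4⟩ := exists_common_bound hq
  obtain ⟨D, hD, h5⟩ := hF
  have hs := summable_prod_pow (norm_nonneg q) hq (K + 1)
  refine .of_norm_bounded (((hs.mul_of_nonneg hs
    (fun _ => Finset.prod_nonneg fun _ _ => by positivity)
    (fun _ => Finset.prod_nonneg fun _ _ => by positivity))).mul_left
    (D * (∏ _i : Fin K, C * C) * C)) fun p => ?_
  rw [chainTerm, norm_mul, norm_mul, norm_prod]
  have hprod : ∏ i : Fin K, ‖qFactSubInv q (p.1 i.succ) (p.1 i.castSucc)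
        * qFactSubInv q (p.2 i.castSucc) (p.2 i.succ) * ((-1) ^ p.1 i.succ
          * q ^ (p.1 i.succ ^ 2 + p.1 i.succ * p.2 i.succ + p.2 i.succ ^ 2))‖
      ≤ ∏ i : Fin K, C * C * (‖q‖ ^ p.1 i.succ * ‖q‖ ^ p.2 i.succ) := by
    refine Finset.prod_le_prod (fun _ _ => norm_nonneg _) fun i _ => ?_
    rw [norm_mul, norm_mul]
    gcongr ?_ * ?_ * ?_
    · exact h4 _ _
    · exact h4 _ _
    · exact norm_chainWeight_le hq _ _
  calc _ ≤ D * (‖q‖ ^ p.1 0 * ‖q‖ ^ p.2 0)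
        * (∏ i : Fin K, C * C * (‖q‖ ^ p.1 i.succ * ‖q‖ ^ p.2 i.succ)) * C := by
        gcongr ?_ * ?_ * ?_
        · exact h5 _ _
        · exact h3 _
    _ = _ := by
        simp only [Fin.prod_univ_succ, Finset.prod_mul_distrib]
        ring

theorem tsum_chainTerm_zero (q : ℂ) (F : ℕ → ℕ → ℂ) :
    ∑' p, chainTerm q 0 F p = chainEnd q F := by
  rw [chainEnd, ← ((Equiv.funUnique (Fin 1) ℕ).prodCongr (Equiv.funUnique (Fin 1) ℕ)).tsum_eq]
  refine tsum_congr fun p => ?_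
  simp [chainTerm]

/-- Absolute convergence allows the first pair to be summed first; with the second pair's weight
this inner sum is `chainNext`. -/
theorem tsum_chainTerm_succ {q : ℂ} (hq : ‖q‖ < 1) (K : ℕ) {F : ℕ → ℕ → ℂ}
    (hF : GeomBound₂ q F) :
    ∑' p, chainTerm q (K + 1) F p = ∑' p, chainTerm q K (chainNext q F) p := by
  let e : ((Fin (K + 1) → ℕ) × (Fin (K + 1) → ℕ)) × (ℕ × ℕ)
      ≃ (Fin (K + 2) → ℕ) × (Fin (K + 2) → ℕ) :=
    (Equiv.prodComm _ _).trans ((Equiv.prodProdProdComm _ _ _ _).trans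
      ((Fin.consEquiv fun _ : Fin (K + 2) => ℕ).prodCongr
        (Fin.consEquiv fun _ : Fin (K + 2) => ℕ)))
  rw [← e.tsum_eq]
  refine ((e.summable_iff.mpr (summable_chainTerm hq (K + 1) hF)).tsum_prod).trans ?_
  refine tsum_congr fun p => ?_
  have he : ∀ c : ℕ × ℕ, e (p, c) = (Fin.cons c.1 p.1, Fin.cons c.2 p.2) := fun _ => rfl
  simp only [chainTerm, chainNext, chainStep, Function.comp_apply]
  rw [← tsum_mul_left, ← tsum_mul_right, ← tsum_mul_right]
  refine tsum_congr fun c => ?_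
  rw [he, Fin.prod_univ_succ]
  simp only [Fin.cons_succ, Fin.cons_zero, Fin.castSucc_zero, ← Fin.succ_castSucc,
    ← Fin.succ_last]
  ring

theorem hasSum_chainTerm {q : ℂ} (hq : ‖q‖ < 1) (K : ℕ) {F : ℕ → ℕ → ℂ}
    (hF : GeomBound₂ q F) :
    HasSum (chainTerm q K F) (chainEnd q ((chainNext q)^[K] F)) := by
  have h : ∑' p, chainTerm q K F p = chainEnd q ((chainNext q)^[K] F) := by
    induction K generalizing F with
    | zero => exact tsum_chainTerm_zero q F
    | succ K ih =>
      rw [tsum_chainTerm_succ hq K hF, ih (geomBound₂_chainNext hq hF),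
        Function.iterate_succ_apply]
  rw [← h]
  exact (summable_chainTerm hq K hF).hasSum

theorem qBinom_eq (q : ℂ) (N M : ℕ) :
    qBinom q N M = qPoch q q N * qFactInv q M * qFactSubInv q N M := by
  unfold qBinom qFactSubInv qFactInv
  split_ifs
  · rw [div_eq_mul_inv, mul_inv]
    ring
  · ring

/-- The numerators of the q-binomials telescope, leaving 1/(q)_{m_1}² and 1/(q)_{n_k}. -/
theorem summand_eq_chainTerm {q : ℂ} (hq : ‖q‖ < 1) (K : ℕ) (m n : Fin (K + 1) → ℕ) :
    (-1 : ℂ) ^ (∑ i, m i)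
        * q ^ (-(n 0 : ℤ) ^ 2 + (n 0 : ℤ)
            + ∑ i, ((m i : ℤ) ^ 2 + (m i : ℤ) * (n i : ℤ) + (n i : ℤ) ^ 2))
        * qPoch (-1) q (n 0) ^ 2
        / (qPoch q q (m (Fin.last K)) * qPoch q q (m 0) * qPoch q q (n 0))
      * (∏ i : Fin K, qBinom q (m i.succ) (m i.castSucc))
      * (∏ i : Fin K, qBinom q (n i.castSucc) (n i.succ))
    = chainTerm q K (chainHead q) (m, n) := by
  -- The n_1² term cancels, so the exponent is a natural number; this also covers q = 0.
  have hexp : (-(n 0 : ℤ) ^ 2 + (n 0 : ℤ)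
        + ∑ i, ((m i : ℤ) ^ 2 + (m i : ℤ) * (n i : ℤ) + (n i : ℤ) ^ 2))
      = ((m 0 ^ 2 + m 0 * n 0 + n 0 + ∑ i : Fin K,
          (m i.succ ^ 2 + m i.succ * n i.succ + n i.succ ^ 2) : ℕ) : ℤ) := by
    rw [Fin.sum_univ_succ]
    push_cast
    ring
  have hne : ∀ j, qPoch q q j ≠ 0 := qPoch_ne_zero hq hq
  have hm : (∏ i : Fin K, qPoch q q (m i.succ)) * (∏ i : Fin K, qFactInv q (m i.castSucc))
      * qFactInv q (m (Fin.last K)) = qFactInv q (m 0) := by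
    rw [mul_assoc, ← Fin.prod_univ_castSucc (f := fun i => qFactInv q (m i)), Fin.prod_univ_succ,
      mul_left_comm, ← Finset.prod_mul_distrib, Finset.prod_eq_one, mul_one]
    exact fun i _ => mul_inv_cancel₀ (hne _)
  have hn : (∏ i : Fin K, qPoch q q (n i.castSucc)) * (∏ i : Fin K, qFactInv q (n i.succ))
      * qFactInv q (n 0) = qFactInv q (n (Fin.last K)) := by
    rw [mul_assoc, mul_comm _ (qFactInv q (n 0)),
      ← Fin.prod_univ_succ (f := fun i => qFactInv q (n i)), Fin.prod_univ_castSucc,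
      ← mul_assoc, ← Finset.prod_mul_distrib, Finset.prod_eq_one, one_mul]
    exact fun i _ => mul_inv_cancel₀ (hne _)
  rw [hexp, zpow_natCast, chainTerm, ← hn]
  simp only [qBinom_eq, Finset.prod_mul_distrib, chainHead]
  rw [Fin.sum_univ_succ, pow_add (-1 : ℂ), ← Finset.prod_pow_eq_pow_sum, pow_add q (_ + n 0),
    ← Finset.prod_pow_eq_pow_sum, pow_two (qFactInv q (m 0))]
  nth_rewrite 2 [← hm]
  simp only [qFactInv, div_eq_mul_inv, mul_inv]
  ring

theorem mainTheorem5 (k : ℕ) (hk : 1 ≤ k) (q : ℂ) (hq : ‖q‖ < 1) :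
    HasSum
      (fun p : (Fin k → ℕ) × (Fin k → ℕ) =>
        let m : Fin k → ℕ := p.1
        let n : Fin k → ℕ := p.2
        let m₁ : ℕ := m ⟨0, by omega⟩
        let mₖ : ℕ := m ⟨k - 1, by omega⟩
        let n₁ : ℕ := n ⟨0, by omega⟩
        (-1 : ℂ) ^ (∑ i, m i)
            * q ^ (-(n₁ : ℤ) ^ 2 + (n₁ : ℤ)
                + ∑ i, ((m i : ℤ) ^ 2 + (m i : ℤ) * (n i : ℤ) + (n i : ℤ) ^ 2))
            * qPoch (-1) q n₁ ^ 2
            / (qPoch q q mₖ * qPoch q q m₁ * qPoch q q n₁)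
          * (∏ i : Fin (k - 1),
              qBinom q (m ⟨i.val + 1, by omega⟩) (m ⟨i.val, by omega⟩))
          * (∏ i : Fin (k - 1),
              qBinom q (n ⟨i.val, by omega⟩) (n ⟨i.val + 1, by omega⟩)))
      (qPochInf (q ^ 2) (q ^ 2) * qPochInf (q ^ (k + 1)) (q ^ (k + 1)) ^ 2
        / (qPochInf q q ^ 3 * qPochInf (q ^ (2 * k + 2)) (q ^ (2 * k + 2)))) := by

  obtain ⟨K, rfl⟩ : ∃ K, k = K + 1 := ⟨k - 1, by omega⟩
  have h := hasSum_chainTerm hq K (geomBound₂_chainHead hq)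
  have hQ : ‖q ^ (K + 1 + 1)‖ < 1 := norm_pow_succ_lt_one hq (K + 1)
  have hval : chainEnd q ((chainNext q)^[K] (chainHead q))
      = qPochInf (q ^ 2) (q ^ 2) * qPochInf (q ^ (K + 1 + 1)) (q ^ (K + 1 + 1)) ^ 2
        / (qPochInf q q ^ 3
          * qPochInf (q ^ (2 * (K + 1) + 2)) (q ^ (2 * (K + 1) + 2))) := by
    have h1 := qPochInf_ne_zero hq hq
    have h2 := qPochInf_ne_zero hQ hQ
    have h3 := qPochInf_ne_zero (norm_neg_lt_one hQ) hQ
    rw [chainEnd_iterate hq, iterate_baileyStep_zero hq, tsum_thetaCoeff hQ, qPochInf_sq_sq hq,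
      show 2 * (K + 1) + 2 = (K + 1 + 1) * 2 by ring, pow_mul, qPochInf_sq_sq hQ]
    field_simp
  rw [← hval]
  exact h.congr_fun fun p => summand_eq_chainTerm hq K p.1 p.2
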